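/- Let $D$ be an integral domain with quotient field $K$. A semistar operation on $D$ is a map $E\mapsto E^\star$ from the set of nonzero $D$-submodules of $K$ to itself such that, for all nonzero $x\in K$ and all nonzero $D$-submodules $E,F$ of $K$: $(xE)^\star=xE^\star$; $E\subseteq F$ implies $E^\star\subseteq F^\star$; $E\subseteq E^\star$ and $(E^\star)^\star=E^\star$. To $\star$ one associates the semistar operation $\star_f$ given by $E^{\star_f}=\bigcup\{F^\star : F\subseteq E,\ F \text{ a nonzero finitely generated } D\text{-submodule of } K\}$. A nonzero ideal $I$ of $D$ is a quasi-$\star_f$-ideal if $I=I^{\star_f}\cap D$, and a nonzero $D$-submodule $E$ of $K$ (in particular, a nonzero ideal of $D$) is $\star_f$-idempotent if $E^{\star_f}=(E^2)^{\star_f}$. The domain $D$ is a Prüfer $\star$-multiplication domain (P$\star$MD) if $(FF^{-1})^{\star_f}=D^{\star_f}$ for every nonzero finitely generated $D$-submodule $F$ of $K$, where $F^{-1}=\{u\in K : uF\subseteq D\}$. Let $\star$ be a semistar operation on $D$ such that $D$ is a P$\star$MD, and let $I$ be a quasi-$\star_f$-ideal of $D$. Then $I$ is $\star_f$-idempotent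 if and only if $I$ is a radical ideal each of whose minimal primes is $\star_f$-idempotent. In particular, let $E^v=(D:(D:E))$, where $(D:E)=\{u\in K : uE\subseteq D\}$, and let $t=v_f$. Suppose that $D$ is a P$v$MD, i.e. $(JJ^{-1})^t=D$ for every nonzero finitely generated ideal $J$ of $D$, and let $I$ be a $t$-ideal of $D$, i.e. a nonzero ideal with $I^t=I$. Then $I$ is $t$-idempotent (i.e. $I^t=(I^2)^t$) if and only if $I$ is a radical ideal each of whose minimal primes is $t$-idempotent. -/

import Mathlib

open scoped Pointwise

noncomputable section

/-- A semistar operation on a domain `D` with quotient field `K`: a closure operation `E ↦ E^⋆`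
on the nonzero `D`-submodules of `K` that commutes with multiplication by nonzero `x ∈ K`.
The map is written as a total function on submodules; all laws, and all notions below, concern
nonzero submodules only, so the value at `⊥` plays no role. Nonzero submodules go to nonzero ones
because `E ≤ E^⋆`. -/
structure SemistarOperation (D K : Type*) [CommRing D] [Field K] [Algebra D K] where
  toFun : Submodule D K → Submodule D K
  map_smul : ∀ (x : K), x ≠ 0 → ∀ E : Submodule D K, E ≠ ⊥ → toFun (x • E) = x • toFun E
  mono : ∀ E F : Submodule D K, E ≠ ⊥ → F ≠ ⊥ → E ≤ F → toFun E ≤ toFun F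
  le_map : ∀ E : Submodule D K, E ≠ ⊥ → E ≤ toFun E
  idem : ∀ E : Submodule D K, E ≠ ⊥ → toFun (toFun E) = toFun E

namespace SemistarOperation

variable {D K : Type*} [CommRing D] [Field K] [Algebra D K]

theorem smul_ne_bot {x : K} (hx : x ≠ 0) {E : Submodule D K} (hE : E ≠ ⊥) : x • E ≠ ⊥ := by
  obtain ⟨y, hy, hy0⟩ := E.ne_bot_iff.1 hE
  exact (Submodule.ne_bot_iff _).2
    ⟨x • y, Submodule.smul_mem_pointwise_smul y x E hy, mul_ne_zero hx hy0⟩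

theorem ne_bot_of_le {E F : Submodule D K} (h : E ≤ F) (hE : E ≠ ⊥) : F ≠ ⊥ := by
  rintro rfl
  exact hE (le_bot_iff.1 h)

/-- The supremum of all `F^⋆`, for `F ≤ E` nonzero and finitely generated.
For `E ≠ ⊥` this is the union of the `F^⋆`, see `mem_finiteTypeFun`. -/
def finiteTypeFun (star : SemistarOperation D K) (E : Submodule D K) : Submodule D K :=
  sSup {G | ∃ F : Submodule D K, F ≠ ⊥ ∧ F.FG ∧ F ≤ E ∧ G = star.toFun F}

theorem mem_finiteTypeFun (star : SemistarOperation D K) {E : Submodule D K} (hE : E ≠ ⊥) (x : K) :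
    x ∈ star.finiteTypeFun E ↔
      ∃ F : Submodule D K, F ≠ ⊥ ∧ F.FG ∧ F ≤ E ∧ x ∈ star.toFun F := by
  unfold finiteTypeFun
  rw [Submodule.mem_sSup_of_directed]
  · constructor
    · rintro ⟨_, ⟨F, h0, hfg, hle, rfl⟩, hx⟩
      exact ⟨F, h0, hfg, hle, hx⟩
    · rintro ⟨F, h0, hfg, hle, hx⟩
      exact ⟨_, ⟨F, h0, hfg, hle, rfl⟩, hx⟩
  · obtain ⟨y, hy, hy0⟩ := E.ne_bot_iff.1 hE
    exact ⟨_, Submodule.span D {y}, by simpa using hy0, Submodule.fg_span_singleton y,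
      by simpa using hy, rfl⟩
  · rintro _ ⟨F, h0, hfg, hle, rfl⟩ _ ⟨F', h0', hfg', hle', rfl⟩
    have hs : F ⊔ F' ≠ ⊥ := ne_bot_of_le le_sup_left h0
    exact ⟨_, ⟨F ⊔ F', hs, hfg.sup hfg', sup_le hle hle', rfl⟩,
      star.mono _ _ h0 hs le_sup_left, star.mono _ _ h0' hs le_sup_right⟩

theorem finiteTypeFun_mono (star : SemistarOperation D K) {E F : Submodule D K} (h : E ≤ F) :
    star.finiteTypeFun E ≤ star.finiteTypeFun F := by
  apply sSup_le_sSup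
  rintro _ ⟨G, h0, hfg, hle, rfl⟩
  exact ⟨G, h0, hfg, hle.trans h, rfl⟩

theorem le_finiteTypeFun (star : SemistarOperation D K) (E : Submodule D K) :
    E ≤ star.finiteTypeFun E := by
  intro y hy
  by_cases hy0 : y = 0
  · rw [hy0]
    exact zero_mem _
  · have h0 : Submodule.span D {y} ≠ ⊥ := by simpa using hy0
    have h1 : star.toFun (Submodule.span D {y}) ≤ star.finiteTypeFun E :=
      le_sSup ⟨_, h0, Submodule.fg_span_singleton y, by simpa using hy, rfl⟩
    exact h1 (star.le_map _ h0 (Submodule.mem_span_singleton_self y))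

theorem smul_finiteTypeFun_le (star : SemistarOperation D K) {x : K} (hx : x ≠ 0)
    {E : Submodule D K} (hE : E ≠ ⊥) :
    x • star.finiteTypeFun E ≤ star.finiteTypeFun (x • E) := by
  intro z hz
  obtain ⟨y, hy, rfl⟩ := Submodule.mem_smul_pointwise_iff_exists _ _ _ |>.1 hz
  obtain ⟨F, h0, hfg, hle, hyF⟩ := (star.mem_finiteTypeFun hE y).1 hy
  refine (star.mem_finiteTypeFun (smul_ne_bot hx hE) _).2
    ⟨x • F, smul_ne_bot hx h0, hfg.map _, Submodule.map_mono hle, ?_⟩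
  rw [star.map_smul x hx F h0]
  exact Submodule.smul_mem_pointwise_smul y x _ hyF

/-- The finite-type semistar operation `⋆_f` associated to `⋆`. -/
def finiteType (star : SemistarOperation D K) : SemistarOperation D K where
  toFun := star.finiteTypeFun
  map_smul := by
    intro x hx E hE
    refine le_antisymm ?_ (star.smul_finiteTypeFun_le hx hE)
    have h := star.smul_finiteTypeFun_le (inv_ne_zero hx) (smul_ne_bot hx hE)
    rw [smul_smul, inv_mul_cancel₀ hx, one_smul] at h
    intro z hz
    have hz' := h (Submodule.smul_mem_pointwise_smul z x⁻¹ _ hz)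
    have h2 := Submodule.smul_mem_pointwise_smul _ x _ hz'
    rwa [smul_smul, mul_inv_cancel₀ hx, one_smul] at h2
  mono := fun _ _ _ _ h => star.finiteTypeFun_mono h
  le_map := fun E _ => star.le_finiteTypeFun E
  idem := by
    intro E hE
    have hE' : star.finiteTypeFun E ≠ ⊥ := ne_bot_of_le (star.le_finiteTypeFun E) hE
    refine le_antisymm ?_ (star.le_finiteTypeFun _)
    intro x hx
    obtain ⟨F, h0, hfg, hle, hxF⟩ := (star.mem_finiteTypeFun hE' x).1 hx
    have key : ∀ G : Submodule D K, G.FG → G ≤ star.finiteTypeFun E →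
        ∃ H : Submodule D K, H ≠ ⊥ ∧ H.FG ∧ H ≤ E ∧ G ≤ star.toFun H := by
      intro G hG
      induction G, hG using Submodule.fg_induction with
      | singleton y =>
        intro hy
        obtain ⟨H, hH0, hHfg, hHle, hyH⟩ := (star.mem_finiteTypeFun hE y).1
          (hy (Submodule.mem_span_singleton_self y))
        exact ⟨H, hH0, hHfg, hHle, by simpa using hyH⟩
      | sup M₁ M₂ _ _ ih₁ ih₂ =>
        intro h
        obtain ⟨H₁, a0, afg, ale, aG⟩ := ih₁ (le_sup_left.trans h)
        obtain ⟨H₂, b0, bfg, ble, bG⟩ := ih₂ (le_sup_right.trans h)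
        have hs : H₁ ⊔ H₂ ≠ ⊥ := ne_bot_of_le le_sup_left a0
        exact ⟨H₁ ⊔ H₂, hs, afg.sup bfg, sup_le ale ble,
          sup_le (aG.trans (star.mono _ _ a0 hs le_sup_left))
            (bG.trans (star.mono _ _ b0 hs le_sup_right))⟩
    obtain ⟨H, hH0, hHfg, hHle, hFH⟩ := key F hfg hle
    refine (star.mem_finiteTypeFun hE x).2 ⟨H, hH0, hHfg, hHle, ?_⟩
    have h1 := star.mono _ _ h0 (ne_bot_of_le (star.le_map H hH0) hH0) hFH
    rw [star.idem H hH0] at h1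
    exact h1 hxF

/-- A nonzero submodule `E` of `K` is `⋆`-idempotent if `E^⋆ = (E²)^⋆`. -/
def IsIdempotent (star : SemistarOperation D K) (E : Submodule D K) : Prop :=
  E ≠ ⊥ ∧ star.toFun E = star.toFun (E ^ 2)

/-- An ideal `I` of `D` is `⋆`-idempotent if it is so as a `D`-submodule of `K`. -/
def IsIdempotentIdeal (star : SemistarOperation D K) (I : Ideal D) : Prop :=
  star.IsIdempotent (IsLocalization.coeSubmodule K I)

/-- A nonzero ideal `I` of `D` is a quasi-`⋆`-ideal if `I = I^⋆ ∩ D`. -/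
def IsQuasiIdeal (star : SemistarOperation D K) (I : Ideal D) : Prop :=
  I ≠ ⊥ ∧ I = (star.toFun (IsLocalization.coeSubmodule K I)).comap (Algebra.linearMap D K)

/-- `D` is a Prüfer `⋆`-multiplication domain: every nonzero finitely generated `D`-submodule `F`
of `K` satisfies `(F F⁻¹)^{⋆_f} = D^{⋆_f}`, where `F⁻¹ = (D : F)` is `1 / F`
(and `D`, as a submodule of `K`, is `1`). -/
def IsPStarMD (star : SemistarOperation D K) : Prop :=
  ∀ F : Submodule D K, F ≠ ⊥ → F.FG →
    star.finiteType.toFun (F * (1 / F)) = star.finiteType.toFun 1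

end SemistarOperation

section VOperation

variable (D K : Type*) [CommRing D] [Field K] [Algebra D K]

/-- `E ↦ (D : (D : E))`, which is `K` when `(D : E) = 0`. -/
def SemistarOperation.v : SemistarOperation D K where
  toFun E := 1 / (1 / E)
  map_smul := by
    intro x hx E _
    ext z
    rw [Submodule.mem_smul_pointwise_iff_exists]
    simp only [Submodule.mem_div_iff_forall_mul_mem, smul_eq_mul]
    constructor
    · intro h
      refine ⟨x⁻¹ * z, fun y hy => ?_, by field_simp⟩
      have := h (x⁻¹ * y) (fun w hw => ?_)
      · convert this using 1
        ring
      · obtain ⟨e, he, rfl⟩ := (Submodule.mem_smul_pointwise_iff_exists _ _ _).1 hw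
        have h2 := hy e he
        convert h2 using 1
        simp only [smul_eq_mul]
        field_simp
    · rintro ⟨u, hu, rfl⟩ y hy
      have := hu (x * y) (fun e he => by
        have h2 := hy (x • e) (Submodule.smul_mem_pointwise_smul e x E he)
        convert h2 using 1
        simp only [smul_eq_mul]
        ring)
      convert this using 1
      ring
  mono := by
    intro E F _ _ h z hz
    rw [Submodule.mem_div_iff_forall_mul_mem] at hz ⊢
    intro y hy
    rw [Submodule.mem_div_iff_forall_mul_mem] at hy
    exact hz y (Submodule.mem_div_iff_forall_mul_mem.2 fun w hw => hy w (h hw))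
  le_map := by
    intro E _ z hz
    rw [Submodule.mem_div_iff_forall_mul_mem]
    intro y hy
    rw [mul_comm]
    exact Submodule.mem_div_iff_forall_mul_mem.1 hy z hz
  idem := by
    intro E _
    ext z
    simp only [Submodule.mem_div_iff_forall_mul_mem]
    constructor
    · intro h y hy
      refine h y fun w hw => ?_
      rw [mul_comm]
      exact hw y hy
    · intro h y hy
      refine h y fun w hw => hy w fun u hu => ?_
      rw [mul_comm]
      exact hu w hw

/-- The `t`-operation `v_f`. -/
def SemistarOperation.t : SemistarOperation D K := (SemistarOperation.v D K).finiteType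

/-- `I` is a `t`-ideal: a nonzero ideal with `I^t = I`. -/
def IsTIdeal (I : Ideal D) : Prop :=
  I ≠ ⊥ ∧ (SemistarOperation.t D K).toFun (IsLocalization.coeSubmodule K I) =
    IsLocalization.coeSubmodule K I

/-- `D` is a P`v`MD: every nonzero finitely generated ideal `J` of `D` is `t`-invertible, that is,
`(J J⁻¹)^t = D`. -/
def IsPvMD : Prop :=
  ∀ J : Ideal D, J ≠ ⊥ → J.FG →
    (SemistarOperation.t D K).toFun
      (IsLocalization.coeSubmodule K J * (1 / IsLocalization.coeSubmodule K J)) = 1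

end VOperation

end

/-!
Call an ideal `J` of `D` *dense* if `1 ∈ J^{⋆_f}`. An ideal maximal among the non-dense ones is
prime, so `J` is dense as soon as it lies in no non-dense prime. In a P⋆MD, `x ∈ I^{⋆_f}` holds for
`x ∈ D` exactly when the colon ideal `(I : x)` is dense, that is, when `x ∈ I D_M` for every
non-dense prime `M`; hence `I` is `⋆_f`-idempotent if and only if all these `I D_M` are idempotent.
Moreover each such `D_M` is a valuation domain, where idempotent ideals are radical and proper
radical ideals are prime. The former makes an idempotent quasi-`⋆_f`-ideal radical, and by the
latter `I D_M = P D_M` when `I` is radical and `P ⊆ M` is a minimal prime of `I`.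
-/

open IsLocalization (coeSubmodule)

section ValuationRing

variable {R : Type*} [CommRing R]

theorem isPrime_of_isRadical_of_preValuationRing [PreValuationRing R] {I : Ideal R}
    (hI : I.IsRadical) (hne : I ≠ ⊤) : I.IsPrime := by
  refine ⟨hne, fun {a b} hab => ?_⟩
  have mem_of_dvd {a b : R} (hab : a * b ∈ I) (hdvd : a ∣ b) : b ∈ I := by
    refine hI ⟨2, I.mem_of_dvd ?_ hab⟩
    rw [sq]
    exact mul_dvd_mul_right hdvd b
  exact (ValuationRing.dvd_total a b).symm.imp (mem_of_dvd (mul_comm a b ▸ hab)) (mem_of_dvd hab)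

theorem isRadical_of_isIdempotentElem_of_preValuationRing [IsDomain R] [PreValuationRing R]
    {I : Ideal R} (hI : IsIdempotentElem I) : I.IsRadical := by
  rw [Ideal.isRadical_iff_pow_one_lt 2 one_lt_two]
  intro x hx
  by_contra hxI
  have hx0 : x ≠ 0 := by rintro rfl; exact hxI I.zero_mem
  have hle : I ≤ Ideal.span {x} :=
    ((PreValuationRing.iff_ideal_total.1 inferInstance).total I (Ideal.span {x})).resolve_right
      fun h => hxI (h (Ideal.mem_span_singleton_self x))
  have hsq : Ideal.span {x} * Ideal.span {x} ≤ I * I := by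
    rwa [hI.eq, Ideal.span_singleton_mul_span_singleton, ← sq, Ideal.span_singleton_le_iff_mem]
  have hmul : Ideal.span {x} * I = Ideal.span {x} * Ideal.span {x} :=
    (Ideal.mul_mono_right hle).antisymm (hsq.trans (Ideal.mul_mono_left hle))
  exact hxI ((Ideal.span_singleton_mul_right_injective hx0 hmul).symm ▸
    Ideal.mem_span_singleton_self x)

theorem map_eq_map_of_mem_minimalPrimes {I P M : Ideal R} [M.IsPrime] (A : Type*) [CommRing A]
    [Algebra R A] [IsLocalization.AtPrime A M] [PreValuationRing A] (hI : I.IsRadical)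
    (hP : P ∈ I.minimalPrimes) (hPM : P ≤ M) :
    I.map (algebraMap R A) = P.map (algebraMap R A) := by
  have hdisj : Disjoint (M.primeCompl : Set R) P :=
    Set.disjoint_left.2 fun _ hxM hxP => hxM (hPM hxP)
  have hmin : P.map (algebraMap R A) ∈ (I.map (algebraMap R A)).minimalPrimes := by
    rw [IsLocalization.minimalPrimes_map M.primeCompl A I, Set.mem_preimage,
      IsLocalization.under_map_of_isPrime_disjoint M.primeCompl A hP.isPrime hdisj]
    exact hP
  have hrad : (I.map (algebraMap R A)).IsRadical := by
    rw [← hI.radical, IsLocalization.map_radical M.primeCompl A]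
    exact Ideal.radical_isRadical _
  have : (I.map (algebraMap R A)).IsPrime := isPrime_of_isRadical_of_preValuationRing hrad
    fun h => hmin.isPrime.ne_top (top_le_iff.1 (h ▸ hmin.le))
  rw [Ideal.minimalPrimes_eq_subsingleton_self] at hmin
  exact (Set.mem_singleton_iff.1 hmin).symm

end ValuationRing

theorem isIdempotentElem_map_iff {R A : Type*} [CommRing R] [CommRing A] {f : R →+* A}
    {I : Ideal R} : IsIdempotentElem (I.map f) ↔ ∀ x ∈ I, f x ∈ (I * I).map f := by
  rw [IsIdempotentElem, Ideal.map_mul, ← Ideal.mul_le_left.ge_iff_eq]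
  exact Ideal.map_le_iff_le_comap

theorem map_eq_top_of_not_le_of_isLocalizationAtPrime {R : Type*} [CommRing R] {I M : Ideal R}
    [M.IsPrime] (A : Type*) [CommRing A] [Algebra R A] [IsLocalization.AtPrime A M] (h : ¬ I ≤ M) :
    I.map (algebraMap R A) = ⊤ := by
  obtain ⟨x, hxI, hxM⟩ := SetLike.not_le_iff_exists.1 h
  exact Ideal.eq_top_of_isUnit_mem _ (Ideal.mem_map_of_mem _ hxI)
    (IsLocalization.map_units A (⟨x, hxM⟩ : M.primeCompl))

namespace SemistarOperation

variable {D K : Type*} [CommRing D] [Field K] [Algebra D K] {star : SemistarOperation D K}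

section FiniteType

theorem finiteTypeFun_bot : star.finiteTypeFun ⊥ = ⊥ := by
  refine sSup_eq_bot.2 ?_
  rintro _ ⟨F, h0, -, hle, rfl⟩
  exact (h0 (le_bot_iff.1 hle)).elim

theorem finiteTypeFun_idem (E : Submodule D K) :
    star.finiteTypeFun (star.finiteTypeFun E) = star.finiteTypeFun E := by
  rcases eq_or_ne E ⊥ with rfl | hE
  · rw [finiteTypeFun_bot, finiteTypeFun_bot]
  · exact star.finiteType.idem E hE

theorem finiteTypeFun_le_iff {E F : Submodule D K} :
    star.finiteTypeFun E ≤ star.finiteTypeFun F ↔ E ≤ star.finiteTypeFun F :=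
  ⟨(star.le_finiteTypeFun E).trans,
    fun h => (star.finiteTypeFun_mono h).trans (finiteTypeFun_idem F).le⟩

theorem finiteTypeFun_mul_le (E F : Submodule D K) :
    star.finiteTypeFun E * F ≤ star.finiteTypeFun (E * F) := by
  rw [Submodule.mul_le]
  intro x hx y hy
  rcases eq_or_ne y 0 with rfl | hy0
  · simp
  rcases eq_or_ne E ⊥ with rfl | hE
  · simpa only [finiteTypeFun_bot, Submodule.bot_mul, Submodule.mem_bot, mul_eq_zero, hy0, or_false]
      using hx
  have hyE : y • E ≤ E * F := by
    rintro _ ⟨e, he, rfl⟩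
    exact (mul_comm e y).subst (motive := (· ∈ E * F)) (Submodule.mul_mem_mul he hy)
  have hyx := star.smul_finiteTypeFun_le hy0 hE (Submodule.smul_mem_pointwise_smul x y _ hx)
  exact mul_comm y x ▸ star.finiteTypeFun_mono hyE hyx

theorem finiteTypeFun_mul_finiteTypeFun_le (E F : Submodule D K) :
    star.finiteTypeFun E * star.finiteTypeFun F ≤ star.finiteTypeFun (E * F) :=
  (finiteTypeFun_mul_le E _).trans <| finiteTypeFun_le_iff.2 <| by
    simpa only [mul_comm] using finiteTypeFun_mul_le F E

theorem exists_coeSubmodule_eq {E : Submodule D K} (h : E ≤ 1) :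
    ∃ J : Ideal D, coeSubmodule K J = E :=
  ⟨E.comap (Algebra.linearMap D K), Submodule.map_comap_eq_self (by
    rwa [← Submodule.one_eq_range])⟩

end FiniteType

/-- The localizing system of `⋆_f`: the ideals `J` with `J^{⋆_f} = D^{⋆_f}`. This is encoded as
`1 ∈ J^{⋆_f}`. -/
def IsDense (star : SemistarOperation D K) (J : Ideal D) : Prop :=
  (1 : K) ∈ star.finiteTypeFun (coeSubmodule K J)

namespace IsDense

theorem mono {I J : Ideal D} (hI : star.IsDense I) (h : I ≤ J) : star.IsDense J :=
  star.finiteTypeFun_mono (IsLocalization.coeSubmodule_mono K h) hI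

theorem top : star.IsDense ⊤ := by
  rw [IsDense, IsLocalization.coeSubmodule_top]
  exact star.le_finiteTypeFun _ (Submodule.one_le.1 le_rfl)

theorem mul {I J : Ideal D} (hI : star.IsDense I) (hJ : star.IsDense J) : star.IsDense (I * J) := by
  rw [IsDense, IsLocalization.coeSubmodule_mul, ← one_mul (1 : K)]
  exact finiteTypeFun_mul_finiteTypeFun_le _ _ (Submodule.mul_mem_mul hI hJ)

theorem isOka : Ideal.IsOka star.IsDense where
  top := top
  oka {I a} hsup hcolon := (hsup.mul hcolon).mono <| by
    rw [Ideal.sup_mul, sup_le_iff]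
    refine ⟨Ideal.mul_le_left, Ideal.mul_le.2 fun x hx r hr => ?_⟩
    exact mul_comm r x ▸ Submodule.mem_colon.1 hr x hx

theorem algebraMap_mem_finiteTypeFun {I : Ideal D} {x : D} (h : star.IsDense (I.colon {x})) :
    algebraMap D K x ∈ star.finiteTypeFun (coeSubmodule K I) := by
  have hx := finiteTypeFun_mul_le _ _ (Submodule.mul_mem_mul h
    (Submodule.mem_span_singleton_self (R := D) (algebraMap D K x)))
  rw [one_mul, ← IsLocalization.coeSubmodule_span_singleton, ← IsLocalization.coeSubmodule_mul]
    at hx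
  refine star.finiteTypeFun_mono (IsLocalization.coeSubmodule_mono K fun y hy => ?_) hx
  obtain ⟨j, hj, rfl⟩ := Ideal.mem_mul_span_singleton.1 hy
  exact Submodule.mem_colon_singleton.1 hj

end IsDense

theorem IsPStarMD.one_mem_finiteTypeFun_mul_one_div (h : star.IsPStarMD) {F : Submodule D K}
    (hF : F ≠ ⊥) (hfg : F.FG) : (1 : K) ∈ star.finiteTypeFun (F * (1 / F)) := by
  have hF1 : star.finiteTypeFun (F * (1 / F)) = star.finiteTypeFun 1 := h F hF hfg
  exact hF1 ▸ star.le_finiteTypeFun 1 (Submodule.one_le.1 le_rfl)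

section FractionField

variable [IsFractionRing D K]

theorem algebraMap_mem_coeSubmodule {I : Ideal D} {x : D} :
    algebraMap D K x ∈ coeSubmodule K I ↔ x ∈ I :=
  (IsFractionRing.injective D K).mem_set_image

theorem coeSubmodule_ne_bot {I : Ideal D} (hI : I ≠ ⊥) : coeSubmodule K I ≠ ⊥ := by
  rw [← IsLocalization.coeSubmodule_bot K]
  exact (IsFractionRing.coeSubmodule_injective D K).ne hI

theorem exists_mul_eq_mul_of_mem_one_div {F : Submodule D K} {a b : D} (ha : algebraMap D K a ∈ F)
    (hb : algebraMap D K b ∈ F) {u : K} (hu : u ∈ 1 / F) :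
    ∃ p q : D, algebraMap D K p = u * algebraMap D K a ∧ algebraMap D K q = u * algebraMap D K b ∧
      p * b = q * a := by
  obtain ⟨p, hp⟩ := Submodule.mem_one.1 (hu _ ha)
  obtain ⟨q, hq⟩ := Submodule.mem_one.1 (hu _ hb)
  refine ⟨p, q, hp, hq, IsFractionRing.injective D K ?_⟩
  rw [map_mul, map_mul, hp, hq, mul_right_comm]

theorem coeSubmodule_mul_one_div_le_colon {I : Ideal D} {x : D} {G : Submodule D K}
    (hI : coeSubmodule K I ≤ G) (hx : algebraMap D K x ∈ G) :
    coeSubmodule K I * (1 / G) ≤ coeSubmodule K (I.colon {x}) := by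
  rw [Submodule.mul_le]
  rintro _ ⟨a, ha, rfl⟩ u hu
  obtain ⟨p, q, hp, -, hpq⟩ :=
    exists_mul_eq_mul_of_mem_one_div (hI (algebraMap_mem_coeSubmodule.2 ha)) hx hu
  refine ⟨p, Submodule.mem_colon_singleton.2 ?_, hp.trans (mul_comm _ _)⟩
  rw [smul_eq_mul, hpq]
  exact I.mul_mem_left q ha

theorem exists_fg_mem_finiteTypeFun {I : Ideal D} {x : K}
    (hx : x ∈ star.finiteTypeFun (coeSubmodule K I)) :
    ∃ J ≤ I, J.FG ∧ x ∈ star.finiteTypeFun (coeSubmodule K J) := by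
  rcases eq_or_ne I ⊥ with rfl | hI
  · exact ⟨⊥, le_rfl, Submodule.fg_bot, hx⟩
  obtain ⟨F, h0, hfg, hle, hxF⟩ :=
    (star.mem_finiteTypeFun (coeSubmodule_ne_bot hI) x).1 hx
  obtain ⟨J, rfl⟩ := exists_coeSubmodule_eq
    (hle.trans (IsLocalization.coeSubmodule_top (R := D) K ▸
      IsLocalization.coeSubmodule_mono K le_top))
  exact ⟨J, IsFractionRing.coeSubmodule_le_coeSubmodule.1 hle,
    (IsLocalization.coeSubmodule_fg K (IsFractionRing.injective D K) J).1 hfg,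
    (star.mem_finiteTypeFun h0 x).2 ⟨_, h0, hfg, le_rfl, hxF⟩⟩

theorem exists_le_maximal_not_isDense {I : Ideal D} (hI : ¬ star.IsDense I) :
    ∃ M, I ≤ M ∧ Maximal (¬ star.IsDense ·) M := by
  refine zorn_le_nonempty₀ {J | ¬ star.IsDense J} (fun c hc hchain J₀ hJ₀ => ?_) I hI
  refine ⟨sSup c, fun hdense => ?_, fun _ => le_sSup⟩
  obtain ⟨F, hle, hfg, hF⟩ := exists_fg_mem_finiteTypeFun hdense
  obtain ⟨J, hJ, hFJ⟩ := (CompleteLattice.isCompactElement_iff_le_of_directed_sSup_le _ _).1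
    ((Submodule.fg_iff_compact F).1 hfg) c ⟨J₀, hJ₀⟩ hchain.directedOn hle
  exact hc hJ (IsDense.mono hF hFJ)

theorem isDense_iff_forall_prime {J : Ideal D} :
    star.IsDense J ↔ ∀ M : Ideal D, M.IsPrime → ¬ star.IsDense M → ¬ J ≤ M := by
  refine ⟨fun hJ M _ hM hJM => hM (hJ.mono hJM), fun h => ?_⟩
  by_contra hJ
  obtain ⟨M, hJM, hM⟩ := exists_le_maximal_not_isDense hJ
  exact h M (IsDense.isOka.isPrime_of_maximal_not hM) hM.prop hJM

theorem IsPStarMD.algebraMap_mem_finiteTypeFun_iff_isDense (h : star.IsPStarMD) {I : Ideal D}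
    {x : D} : algebraMap D K x ∈ star.finiteTypeFun (coeSubmodule K I) ↔
      star.IsDense (I.colon {x}) := by
  refine ⟨fun hx => ?_, IsDense.algebraMap_mem_finiteTypeFun⟩
  rcases eq_or_ne x 0 with rfl | hx0
  · exact IsDense.top.mono fun _ _ => by simp
  obtain ⟨A, hAI, hAfg, hxA⟩ := exists_fg_mem_finiteTypeFun hx
  -- As `x ∈ A^{⋆_f}`, the module `G = A + Dx` has the same `⋆_f`-closure as `A`, so `A G⁻¹` may
  -- replace `G G⁻¹`; and `A G⁻¹ ⊆ (A : x)` because `x ∈ G`.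
  set G : Submodule D K := coeSubmodule K A ⊔ Submodule.span D {algebraMap D K x}
  have hxG : algebraMap D K x ∈ G := Submodule.mem_sup_right (Submodule.mem_span_singleton_self _)
  have hG0 : G ≠ ⊥ := (Submodule.ne_bot_iff G).2
    ⟨_, hxG, (map_ne_zero_iff _ (IsFractionRing.injective D K)).2 hx0⟩
  have hGA : G ≤ star.finiteTypeFun (coeSubmodule K A) :=
    sup_le (star.le_finiteTypeFun _) ((Submodule.span_singleton_le_iff_mem _ _).2 hxA)
  have hG : G * (1 / G) ≤ star.finiteTypeFun (coeSubmodule K (A.colon {x})) :=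
    (mul_le_mul_left hGA _).trans <| (finiteTypeFun_mul_le _ _).trans <|
      star.finiteTypeFun_mono (coeSubmodule_mul_one_div_le_colon le_sup_left hxG)
  have hA : star.IsDense (A.colon {x}) := finiteTypeFun_le_iff.2 hG <|
    h.one_mem_finiteTypeFun_mul_one_div hG0
      (Submodule.FG.sup (Submodule.FG.map _ hAfg) (Submodule.fg_span_singleton _))
  exact hA.mono (Submodule.colon_mono hAI subset_rfl)

theorem IsPStarMD.algebraMap_mem_finiteTypeFun_iff (h : star.IsPStarMD) {I : Ideal D} {x : D} :
    algebraMap D K x ∈ star.finiteTypeFun (coeSubmodule K I) ↔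
      ∀ (M : Ideal D) [M.IsPrime], ¬ star.IsDense M →
        algebraMap D (Localization.AtPrime M) x ∈
          I.map (algebraMap D (Localization.AtPrime M)) := by
  rw [h.algebraMap_mem_finiteTypeFun_iff_isDense, isDense_iff_forall_prime]
  refine forall₃_congr fun M _ _ => ?_
  rw [IsLocalization.algebraMap_mem_map_algebraMap_iff M.primeCompl, SetLike.not_le_iff_exists]
  simp only [Submodule.mem_colon_singleton, smul_eq_mul, Ideal.mem_primeCompl_iff, and_comm]

theorem IsPStarMD.dvd_or_dvd_localization (h : star.IsPStarMD) {M : Ideal D} [M.IsPrime]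
    (hM : ¬ star.IsDense M) (a b : D) :
    algebraMap D (Localization.AtPrime M) a ∣ algebraMap D (Localization.AtPrime M) b ∨
      algebraMap D (Localization.AtPrime M) b ∣ algebraMap D (Localization.AtPrime M) a := by
  rcases eq_or_ne a 0 with rfl | ha
  · simp
  by_contra! hcon
  set F : Submodule D K := Submodule.span D {algebraMap D K a, algebraMap D K b}
  have haF : algebraMap D K a ∈ F := Submodule.subset_span (by simp)
  have hbF : algebraMap D K b ∈ F := Submodule.subset_span (by simp)
  have hF0 : F ≠ ⊥ := (Submodule.ne_bot_iff F).2
    ⟨_, haF, (map_ne_zero_iff _ (IsFractionRing.injective D K)).2 ha⟩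
  have dvd_of_notMem {s c d e : D} (hs : s ∉ M) (hsc : s * c = d * e) :
      algebraMap D (Localization.AtPrime M) e ∣ algebraMap D (Localization.AtPrime M) c :=
    (IsLocalization.map_units (Localization.AtPrime M) (⟨s, hs⟩ : M.primeCompl)).dvd_mul_left.1
      ⟨algebraMap D _ d, by rw [← map_mul, ← map_mul, hsc, mul_comm]⟩
  -- `u ∈ F⁻¹` satisfies `(u a) b = (u b) a` in `D`, so a unit `u a` or `u b` of `D_M` would yield
  -- a divisibility between `a` and `b`.
  have hle : F * (1 / F) ≤ coeSubmodule K M := by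
    rw [← Submodule.le_div_iff_mul_le, Submodule.span_le, Set.pair_subset_iff]
    have mul_mem {u : K} (hu : u ∈ 1 / F) : u * algebraMap D K a ∈ coeSubmodule K M ∧
        u * algebraMap D K b ∈ coeSubmodule K M := by
      obtain ⟨p, q, hp, hq, hpq⟩ := exists_mul_eq_mul_of_mem_one_div haF hbF hu
      rw [← hp, ← hq, algebraMap_mem_coeSubmodule, algebraMap_mem_coeSubmodule]
      exact ⟨not_imp_comm.1 (dvd_of_notMem · hpq) hcon.1,
        not_imp_comm.1 (dvd_of_notMem · hpq.symm) hcon.2⟩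
    exact ⟨fun u hu => mul_comm u (algebraMap D K a) ▸ (mul_mem hu).1,
      fun u hu => mul_comm u (algebraMap D K b) ▸ (mul_mem hu).2⟩
  exact hM (star.finiteTypeFun_mono hle
    (h.one_mem_finiteTypeFun_mul_one_div hF0 (Submodule.fg_span (Set.toFinite _))))

theorem IsPStarMD.preValuationRing_localization (h : star.IsPStarMD) {M : Ideal D}
    [M.IsPrime] (hM : ¬ star.IsDense M) : PreValuationRing (Localization.AtPrime M) := by
  refine PreValuationRing.iff_dvd_total.2 ⟨fun z w => ?_⟩
  obtain ⟨a, b, d, hz, hw⟩ := IsLocalization.surj₂ M.primeCompl (Localization.AtPrime M) z w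
  have hd := IsLocalization.map_units (Localization.AtPrime M) d
  simpa only [← hz, ← hw, hd.mul_right_dvd, hd.dvd_mul_right] using h.dvd_or_dvd_localization hM a b

theorem isIdempotentIdeal_finiteType_iff {I : Ideal D} (hI : I ≠ ⊥) :
    star.finiteType.IsIdempotentIdeal I ↔
      ∀ x ∈ I, algebraMap D K x ∈ star.finiteTypeFun (coeSubmodule K (I * I)) := by
  have hsq : coeSubmodule K (I * I) ≤ coeSubmodule K I :=
    IsLocalization.coeSubmodule_mono K Ideal.mul_le_left
  have hdef : star.finiteType.IsIdempotentIdeal I ↔ coeSubmodule K I ≠ ⊥ ∧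
      star.finiteTypeFun (coeSubmodule K I) = star.finiteTypeFun (coeSubmodule K (I * I)) := by
    rw [IsLocalization.coeSubmodule_mul, ← sq]; rfl
  rw [hdef, and_iff_right (coeSubmodule_ne_bot hI),
    ← (star.finiteTypeFun_mono hsq).ge_iff_eq', finiteTypeFun_le_iff]
  exact Submodule.map_le_iff_le_comap

theorem IsPStarMD.isIdempotentIdeal_iff_localization (h : star.IsPStarMD) {I : Ideal D}
    (hI : I ≠ ⊥) : star.finiteType.IsIdempotentIdeal I ↔
      ∀ (M : Ideal D) [M.IsPrime], ¬ star.IsDense M →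
        IsIdempotentElem (I.map (algebraMap D (Localization.AtPrime M))) := by
  simp only [isIdempotentIdeal_finiteType_iff hI, h.algebraMap_mem_finiteTypeFun_iff,
    isIdempotentElem_map_iff]
  exact ⟨fun H M _ hM x hx => H x hx M hM, fun H x hx M _ hM => H M hM x hx⟩

theorem IsPStarMD.isRadical_of_forall_localization (h : star.IsPStarMD) {I : Ideal D}
    (hI : star.finiteType.IsQuasiIdeal I)
    (hrad : ∀ (M : Ideal D) [M.IsPrime], ¬ star.IsDense M →
      (I.map (algebraMap D (Localization.AtPrime M))).IsRadical) : I.IsRadical := by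
  intro x hx
  rw [hI.2]
  exact h.algebraMap_mem_finiteTypeFun_iff.2 fun M _ hM =>
    hrad M hM (Ideal.map_radical_le _ (Ideal.mem_map_of_mem _ hx))

theorem IsPStarMD.isIdempotentIdeal_iff_isRadical [IsDomain D] (h : star.IsPStarMD) {I : Ideal D}
    (hI : star.finiteType.IsQuasiIdeal I) :
    star.finiteType.IsIdempotentIdeal I ↔
      I.IsRadical ∧ ∀ P ∈ I.minimalPrimes, star.finiteType.IsIdempotentIdeal P := by
  have hmin0 {P : Ideal D} (hP : P ∈ I.minimalPrimes) : P ≠ ⊥ := ne_bot_of_le_ne_bot hI.1 hP.le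
  rw [h.isIdempotentIdeal_iff_localization hI.1]
  constructor
  · intro hidem
    have hrad : I.IsRadical := h.isRadical_of_forall_localization hI fun M _ hM =>
      have := h.preValuationRing_localization hM
      isRadical_of_isIdempotentElem_of_preValuationRing (hidem M hM)
    refine ⟨hrad, fun P hP => (h.isIdempotentIdeal_iff_localization (hmin0 hP)).2 fun M _ hM => ?_⟩
    have := h.preValuationRing_localization hM
    by_cases hPM : P ≤ M
    · rw [← map_eq_map_of_mem_minimalPrimes _ hrad hP hPM]
      exact hidem M hM
    · rw [map_eq_top_of_not_le_of_isLocalizationAtPrime _ hPM]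
      exact Ideal.mul_top ⊤
  · rintro ⟨hrad, hmin⟩ M _ hM
    have := h.preValuationRing_localization hM
    by_cases hIM : I ≤ M
    · obtain ⟨P, hP, hPM⟩ := Ideal.exists_minimalPrimes_le hIM
      rw [map_eq_map_of_mem_minimalPrimes _ hrad hP hPM]
      exact (h.isIdempotentIdeal_iff_localization (hmin0 hP)).1 (hmin P hP) M hM
    · rw [map_eq_top_of_not_le_of_isLocalizationAtPrime _ hIM]
      exact Ideal.mul_top ⊤

theorem exists_smul_eq_coeSubmodule {F : Submodule D K} (hF : F ≠ ⊥) (hfg : F.FG) :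
    ∃ x : K, x ≠ 0 ∧ ∃ J : Ideal D, J ≠ ⊥ ∧ J.FG ∧ x • F = coeSubmodule K J := by
  obtain ⟨d, hd, hdF⟩ := FractionalIdeal.isFractional_of_fg (S := nonZeroDivisors D) hfg
  have hd0 : algebraMap D K d ≠ 0 :=
    (IsLocalization.map_units K (⟨d, hd⟩ : nonZeroDivisors D)).ne_zero
  have hle : algebraMap D K d • F ≤ 1 := by
    rintro _ ⟨y, hy, rfl⟩
    obtain ⟨e, he⟩ := hdF y hy
    exact Submodule.mem_one.2 ⟨e, he.trans (Algebra.smul_def d y)⟩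
  obtain ⟨J, hJ⟩ := exists_coeSubmodule_eq hle
  refine ⟨_, hd0, J, ?_, ?_, hJ.symm⟩
  · rintro rfl
    exact smul_ne_bot hd0 hF (hJ.symm.trans (IsLocalization.coeSubmodule_bot K))
  · exact (IsLocalization.coeSubmodule_fg K (IsFractionRing.injective D K) J).1 (hJ ▸ hfg.map _)

end FractionField

theorem smul_mul_one_div_smul {x : K} (hx : x ≠ 0) (E : Submodule D K) :
    (x • E) * (1 / (x • E)) = E * (1 / E) := by
  have hinv : 1 / (x • E) = x⁻¹ • (1 / E) := by
    ext u
    rw [← SetLike.mem_coe (p := x⁻¹ • (1 / E)), Submodule.coe_pointwise_smul,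
      Set.mem_inv_smul_set_iff₀ hx, SetLike.mem_coe, Submodule.mem_div_iff_forall_mul_mem,
      Submodule.mem_div_iff_forall_mul_mem]
    refine Set.forall_mem_image.trans (forall₂_congr fun e _ => ?_)
    rw [DistribSMul.toLinearMap_apply, smul_eq_mul, smul_eq_mul, mul_left_comm, mul_assoc]
  rw [hinv, smul_mul_smul_comm, mul_inv_cancel₀ hx, one_smul]

end SemistarOperation

theorem IsPvMD.isPStarMD {D K : Type*} [CommRing D] [Field K] [Algebra D K] [IsFractionRing D K]
    (h : IsPvMD D K) : (SemistarOperation.v D K).IsPStarMD := by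
  have : Nontrivial D := (IsFractionRing.nontrivial_iff_nontrivial D K).2 inferInstance
  have htop : (SemistarOperation.t D K).toFun 1 = 1 := by
    have hone : (1 : Submodule D K) * (1 / 1) = 1 :=
      Submodule.mul_one_div_le_one.antisymm (Submodule.le_self_mul_one_div le_rfl)
    simpa only [IsLocalization.coeSubmodule_top, hone] using h ⊤ top_ne_bot (Ideal.fg_top D)
  intro F hF hfg
  obtain ⟨x, hx, J, hJ0, hJfg, hJ⟩ := SemistarOperation.exists_smul_eq_coeSubmodule hF hfg
  have hJinv := h J hJ0 hJfg
  rw [← hJ, SemistarOperation.smul_mul_one_div_smul hx] at hJinv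
  exact hJinv.trans htop.symm

theorem IsTIdeal.isQuasiIdeal {D K : Type*} [CommRing D] [Field K] [Algebra D K]
    [IsFractionRing D K] {I : Ideal D} (h : IsTIdeal D K I) :
    (SemistarOperation.t D K).IsQuasiIdeal I := by
  refine ⟨h.1, ?_⟩
  rw [h.2]
  ext x
  exact SemistarOperation.algebraMap_mem_coeSubmodule.symm

theorem mainTheorem3 (D K : Type*) [CommRing D] [IsDomain D] [Field K] [Algebra D K]
    [IsFractionRing D K] :
    (∀ star : SemistarOperation D K, star.IsPStarMD →
      ∀ I : Ideal D, star.finiteType.IsQuasiIdeal I →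
        (star.finiteType.IsIdempotentIdeal I ↔
          I.IsRadical ∧ ∀ P ∈ I.minimalPrimes, star.finiteType.IsIdempotentIdeal P)) ∧
    (IsPvMD D K →
      ∀ I : Ideal D, IsTIdeal D K I →
        ((SemistarOperation.t D K).IsIdempotentIdeal I ↔
          I.IsRadical ∧
            ∀ P ∈ I.minimalPrimes, (SemistarOperation.t D K).IsIdempotentIdeal P)) := by
  constructor
  · intro star hstar I hI
    exact hstar.isIdempotentIdeal_iff_isRadical hI
  · intro hD I hI
    exact hD.isPStarMD.isIdempotentIdeal_iff_isRadical hI.isQuasiIdeal
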